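/- **Setting.** Let $\phi_j$ ($j\in\frac12+\mathbb Z$) be free bosons with $\phi_i\phi_j-\phi_j\phi_i=(-1)^{j-\frac12}\delta_{i,-j}$, acting on the Fock space with vacuum $|0\rangle$ and basis $\phi_{j_1}^{m_1}\cdots\phi_{j_r}^{m_r}|0\rangle$ ($j_1>\dots>j_r>0$), where $\phi_j|0\rangle=0$ for $j<0$; let $\langle 0|$ be the dual vacuum, $\langle 0|\phi_j=0$ for $j>0$, $\langle 0|0\rangle=1$. For odd $n>0$ put $J_n=\frac12\sum_{j\in\frac12+\mathbb Z}(-1)^{j+\frac12}\phi_j\phi_{-j-n}$, and for commuting times $t=(t_1,t_3,t_5,\dots)$ put $\Gamma(t)=\exp\big(\sum_{n>0\text{ odd}}t_nJ_n\big)$ (all Grassmann odd times are set to zero). For a partition $\lambda=(\lambda_1\ge\dots\ge\lambda_\ell>0)$ with odd parts $\lambda_i=2n_i+1$, write $\ell(\lambda)=\ell$, $|\lambda|=\sum_i\lambda_i$, let $m_p$ be the multiplicity of $p$ in $\lambda$, fix any $d_\lambda\in\mathbb C$ with $d_\lambda^2=(-1)^{\sum_i n_i}\prod_{p}m_p!$,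 and define $$C_\lambda(t)=\frac1{d_\lambda}\,\langle 0|\,\Gamma(t)\,\phi_{\lambda_1/2}\cdots\phi_{\lambda_\ell/2}\,|0\rangle .$$ Define $h_k(t)$ by $\sum_k h_k(t)z^k=\exp\big(\sum_{n>0\text{ odd}}t_nz^n\big)$ ($h_k=0$ for $k<0$), $s_\mu(t)=\det\big(h_{\mu_i-i+j}(t)\big)$, and let $s_{(n|m)}$ be the Schur function of the hook $(n+1,1^m)$. The Hafnian of a symmetric matrix $A$ of even order $2k$ is $\mathrm{Hf}(A)=\sum_\sigma A_{\sigma(1),\sigma(2)}\cdots A_{\sigma(2k-1),\sigma(2k)}$, over the permutations $\sigma$ with $\sigma(2i-1)<\sigma(2i)$ and $\sigma(1)<\sigma(3)<\dots<\sigma(2k-1)$. **Claim.** One has $s_{(n|m)}(t)=s_{(m|n)}(t)$ for all $n,m\ge0$, and $C_{(2n+1,2m+1)}(t)=\frac1{d_{(2n+1,2m+1)}}\,s_{(n|m)}(t)$ for all $n\ge m\ge 0$. For every partition $\lambda$ with odd parts: 1. if $\ell(\lambda)$ is odd, then $C_\lambda(t)=0$; 2. if $\ell(\lambda)$ is even,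 then $C_\lambda(t)=\frac1{d_\lambda}\,\mathrm{Hf}\big[s_{(n_i|n_j)}(t)\big]_{1\le i,j\le\ell(\lambda)}$; 3. if $\ell(\lambda)$ is even, then $C_\lambda(-t)=(-1)^{|\lambda|/2}\,C_\lambda(t)$. -/

import Mathlib

open scoped Nat

noncomputable section

namespace CKP

/-! ### Free bosons and their Fock space

A half-integer `j ∈ 1/2 + ℤ` is encoded by the integer `k` with `j = k + 1/2`; then `-j` is encoded
by `-k - 1`. The even times `t = (t₁, t₃, t₅, …)` are a sequence `t : ℕ → R` with `t k = t_{2k+1}`,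
where `R` is any commutative `ℂ`-algebra (complex values, formal variables, …). -/

/-- The bosonic Fock space with coefficients in `R`: the basis vector
`φ_{j₁}^{m₁} ⋯ φ_{jₙ}^{mₙ} |0⟩` with `jᵢ = kᵢ + 1/2 > 0` is the monomial `∏ X_{kᵢ}^{mᵢ}`. -/
abbrev Fock (R : Type*) [CommRing R] : Type _ := MvPolynomial ℕ R

/-- The vacuum vector `|0⟩`. -/
def vacuum (R : Type*) [CommRing R] : Fock R := 1

/-- The dual vacuum `⟨0|`, as a function on the Fock space: the coefficient of `|0⟩`. -/
def dualVacuum {R : Type*} [CommRing R] (v : Fock R) : R := MvPolynomial.constantCoeff v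

/-- The free boson `φ_{k + 1/2}`. For `k ≥ 0` it is multiplication by `X_k`; for `k = -m - 1 < 0`
it is `(-1)^m ∂/∂X_m`, so that `φ_i φ_j - φ_j φ_i = (-1)^{j - 1/2} δ_{i,-j}` and
`φ_j |0⟩ = 0` for `j < 0`, `⟨0| φ_j = 0` for `j > 0`. -/
def phi {R : Type*} [CommRing R] : ℤ → Module.End R (Fock R)
  | Int.ofNat m => LinearMap.mulLeft R (MvPolynomial.X m)
  | Int.negSucc m => (-1 : R) ^ m • (MvPolynomial.pderiv m : Derivation R (Fock R) (Fock R))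

/-- The defining commutation relations of the free bosons. -/
theorem phi_comm {R : Type*} [CommRing R] (k l : ℤ) (v : Fock R) :
    phi k (phi l v) - phi l (phi k v) = if k = -l - 1 then l.negOnePow • v else 0 := by
  rcases k with k | k <;> rcases l with l | l
  · have hne : ¬ (Int.ofNat k = -Int.ofNat l - 1) := by simp only [Int.ofNat_eq_natCast]; omega
    rw [if_neg hne]
    simp only [phi, LinearMap.mulLeft_apply]
    ring
  · have hs : (Int.negSucc l).negOnePow = -((l : ℤ).negOnePow) := by
      rw [Int.negSucc_eq, Int.negOnePow_neg, Int.negOnePow_succ]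
    rw [hs]
    simp only [phi, LinearMap.mulLeft_apply, LinearMap.smul_apply, Derivation.coeFn_coe,
      Derivation.leibniz, MvPolynomial.pderiv_X, Int.ofNat_eq_natCast, Int.negSucc_eq,
      Int.negOnePow_def, zpow_natCast, Units.smul_def]
    by_cases hkl : k = l
    · subst hkl
      simp [MvPolynomial.smul_eq_C_mul]
      ring
    · have h2 : ¬ ((k : ℤ) = -(-((l : ℤ) + 1)) - 1) := by omega
      have h3 : (Pi.single l 1 : ℕ → MvPolynomial ℕ R) k = 0 := Pi.single_eq_of_ne hkl _
      rw [if_neg h2]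
      simp [h3]
  · simp only [phi, LinearMap.mulLeft_apply, LinearMap.smul_apply, Derivation.coeFn_coe,
      Derivation.leibniz, MvPolynomial.pderiv_X, Int.ofNat_eq_natCast, Int.negSucc_eq,
      Int.negOnePow_def, zpow_natCast, Units.smul_def]
    by_cases hkl : k = l
    · subst hkl
      have h2 : -((k : ℤ) + 1) = -(k : ℤ) - 1 := by omega
      rw [if_pos h2]
      simp [MvPolynomial.smul_eq_C_mul]
      ring
    · have h2 : ¬ (-((k : ℤ) + 1) = -(l : ℤ) - 1) := by omega
      have h3 : (Pi.single k 1 : ℕ → MvPolynomial ℕ R) l = 0 :=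
        Pi.single_eq_of_ne (Ne.symm hkl) _
      rw [if_neg h2]
      simp [h3]
  · have hne : ¬ (Int.negSucc k = -Int.negSucc l - 1) := by
      simp only [Int.negSucc_eq]; omega
    rw [if_neg hne]
    have hc : ⁅(MvPolynomial.pderiv k : Derivation R (Fock R) (Fock R)),
        (MvPolynomial.pderiv l : Derivation R (Fock R) (Fock R))⁆ = 0 := by
      apply MvPolynomial.derivation_ext
      intro i
      rw [Derivation.commutator_apply]
      simp [MvPolynomial.pderiv_X, Pi.single_apply, apply_ite]
    have hv := DFunLike.congr_fun hc v
    rw [Derivation.commutator_apply, Derivation.zero_apply] at hv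
    simp only [phi, LinearMap.smul_apply, Derivation.coeFn_coe, map_smul]
    rw [smul_comm ((-1 : R) ^ l), ← smul_sub, ← smul_sub, hv, smul_zero, smul_zero]

variable {R : Type*} [CommRing R] [Algebra ℂ R]

/-- `J_n = (1/2) ∑_{j ∈ 1/2 + ℤ} (-1)^{j + 1/2} φ_j φ_{-j-n}` for odd `n > 0`. For such `n`, only
finitely many terms are nonzero on a given vector. -/
def J (n : ℕ) (v : Fock R) : Fock R :=
  (1 / 2 : ℂ) • ∑ᶠ k : ℤ, (k + 1).negOnePow • phi k (phi (-k - 1 - n) v)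

/-- `H(t) = ∑_{n > 0 odd} t_n J_n`, a locally finite sum. This is the exponent `J(𝐭)` of `Γ(𝐭)` when
all the Grassmann odd times vanish. -/
def H (t : ℕ → R) (v : Fock R) : Fock R := ∑ᶠ m : ℕ, t m • J (2 * m + 1) v

/-- `Γ(t) = exp H(t) = ∑_r H(t)^r / r!`, where `H(t)` is locally nilpotent. -/
def Gamma (t : ℕ → R) (v : Fock R) : Fock R := ∑ᶠ r : ℕ, ((r ! : ℂ)⁻¹) • (H t)^[r] v

/-! ### Partitions with odd parts and the functions `C_λ` -/

/-- A partition `λ₁ ≥ λ₂ ≥ ⋯ ≥ λ_ℓ > 0` all of whose parts are odd. -/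
structure OddPartition where
  /-- the length `ℓ(λ)` -/
  length : ℕ
  /-- the parts `λ_i` -/
  parts : Fin length → ℕ
  antitone : Antitone parts
  odd : ∀ i, Odd (parts i)

namespace OddPartition

/-- The number `n_i` with `λ_i = 2 n_i + 1`. -/
def half (lam : OddPartition) (i : Fin lam.length) : ℕ := lam.parts i / 2

/-- The weight `|λ| = ∑ λ_i`. -/
def weight (lam : OddPartition) : ℕ := ∑ i, lam.parts i

/-- The multiplicity `m_p(λ)` of the number `p` as a part of `λ`. -/
def mult (lam : OddPartition) (p : ℕ) : ℕ := (Finset.univ.filter fun i => lam.parts i = p).card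

/-- The number `(d_λ)² = (-1)^{∑ n_i} ∏_p m_p(λ)!`, the product over the distinct parts `p`. -/
def dSq (lam : OddPartition) : ℂ :=
  (-1) ^ (∑ i, lam.half i) * ∏ p ∈ Finset.univ.image lam.parts, ((lam.mult p)! : ℂ)

/-- The two-part partition `(2a + 1, 2b + 1)`, where `b ≤ a`. -/
def pair (a b : ℕ) (h : b ≤ a) : OddPartition where
  length := 2
  parts := ![2 * a + 1, 2 * b + 1]
  antitone := by
    rw [Fin.antitone_iff_succ_le]
    intro i
    fin_cases i
    simpa using h
  odd := by
    intro i
    fin_cases i <;> simp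

end OddPartition

/-- `d` chooses for every `λ` a number `d_λ` whose square is the prescribed `(d_λ)²`. -/
def IsNormalization (d : OddPartition → ℂ) : Prop := ∀ lam, d lam ^ 2 = lam.dSq

/-- The basis vector `|λ⟩ = (1/d_λ) φ_{λ₁/2} ⋯ φ_{λ_ℓ/2} |0⟩`; note `λ_i/2 = n_i + 1/2`. -/
def ket (R : Type*) [CommRing R] [Algebra ℂ R] (d : OddPartition → ℂ) (lam : OddPartition) :
    Fock R :=
  (d lam)⁻¹ • (List.ofFn fun i => phi (lam.half i : ℤ)).prod (vacuum R)

/-- `C_λ(t) = ⟨0| Γ(t) |λ⟩`, at vanishing Grassmann odd times. -/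
def C (d : OddPartition → ℂ) (lam : OddPartition) (t : ℕ → R) : R :=
  dualVacuum (Gamma t (ket R d lam))

/-! ### Schur functions in the times -/

/-- The series `∑_{n > 0 odd} t_n z^n`. -/
def timeSeries (t : ℕ → R) : PowerSeries R :=
  PowerSeries.mk fun n => if Odd n then t (n / 2) else 0

/-- The complete symmetric functions `h_n(t)`, with
`∑_n h_n(t) z^n = exp (∑_{k > 0 odd} t_k z^k)`, and `h_n = 0` for `n < 0`. -/
def h (t : ℕ → R) : ℤ → R
  | Int.ofNat n => PowerSeries.coeff n ((PowerSeries.exp ℂ).subst (timeSeries t))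
  | Int.negSucc _ => 0

/-- The Schur function `s_μ(t) = det (h_{μ_i - i + j}(t))` (Jacobi-Trudi) of the partition
`μ = (μ₀, …, μ_{l-1})`, in the times `t_n = p_n / n`. -/
def schur {l : ℕ} (t : ℕ → R) (mu : Fin l → ℕ) : R :=
  (Matrix.of fun i j : Fin l => h t ((mu i : ℤ) - (i : ℤ) + (j : ℤ))).det

/-- The one-hook Schur function `s_{(n|m)}(t)`: in Frobenius notation `(n|m)` is the partition
`(n + 1, 1, …, 1)` with `m` ones, of arm `n` and leg `m`. -/
def schurHook (t : ℕ → R) (n m : ℕ) : R :=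
  schur t (Fin.cons (n + 1) (fun _ => 1) : Fin (m + 1) → ℕ)

/-- The matrix `[s_{(n_i|n_j)}(t)]` attached to `λ`. -/
def hookMatrix (lam : OddPartition) (t : ℕ → R) : Matrix (Fin lam.length) (Fin lam.length) R :=
  Matrix.of fun i j => schurHook t (lam.half i) (lam.half j)

/-! ### The Hafnian -/

/-- The index in position `2i - 1` (counting from one) among `n`. -/
def fstIdx {n : ℕ} (i : Fin (n / 2)) : Fin n := ⟨2 * i, by omega⟩

/-- The index in position `2i` (counting from one) among `n`. -/
def sndIdx {n : ℕ} (i : Fin (n / 2)) : Fin n := ⟨2 * i + 1, by omega⟩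

/-- The Hafnian of a symmetric matrix `A` of even order `n = 2k`: the sum of
`A_{σ(1),σ(2)} ⋯ A_{σ(2k-1),σ(2k)}` over the permutations `σ` with `σ(2i-1) < σ(2i)` and
`σ(1) < σ(3) < ⋯ < σ(2k-1)`. -/
def hafnian {S : Type*} [CommRing S] {n : ℕ} (A : Matrix (Fin n) (Fin n) S) : S :=
  open Classical in
  ∑ σ ∈ (Finset.univ : Finset (Equiv.Perm (Fin n))).filter
    (fun σ => (∀ i : Fin (n / 2), σ (fstIdx i) < σ (sndIdx i)) ∧
      StrictMono fun i : Fin (n / 2) => σ (fstIdx i)),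
    ∏ i : Fin (n / 2), A (σ (fstIdx i)) (σ (sndIdx i))

end CKP

end

/-!
All results follow from the commutation relation `[J_n, φ_l] = φ_{l-n}`; here and below, in
comments, `φ_l` with integral `l` stands for `phi l`, the boson with half-integral index
`l + 1/2`. It gives `[H(t), ∑_i F_i φ_{k-i}] = ∑_i (T F)_i φ_{k-i}` for every power series `F`,
where `T` is the series of the times, and since `H(t)` is locally nilpotent, exponentiation gives
`Γ(t) φ_k Γ(t)⁻¹ = ∑_i h_i(t) φ_{k-i}` (`GammaEnd_phi`). In `⟨0| Γ(t) φ_k v` the creation part of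
this operator is killed by `⟨0|`, and the annihilation part can be commuted to the right until it
kills the vacuum. It has scalar commutators with the conjugated creation operators, so that
conjugating it back gives a derivation, the contraction with `φ_k` (`annihilation_GammaEnd`). This
is Wick's theorem (`correlator_X_mul`), with the two-point function
`∑_p (-1)^p h_{k+1+p} h_{l-p}`.

The recursion for the correlators `⟨0| Γ(t) φ_{k_1} ⋯ φ_{k_n} |0⟩` that follows (`nPoint_succ_succ`)
is the expansion of a Hafnian along its first row (`hafnian_succ_succ`), and it ends in `0` if `n`
is odd. The two-point function is symmetric because creation operators commute. This symmetry
includes `∑_p (-1)^p h_{1+p} h_{l-p} = h_{l+1}`, the relation `e_{l+1} = h_{l+1}` between elementary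
and complete symmetric functions at odd times. With it, expanding the Jacobi-Trudi determinant of a
hook along its first column identifies the hook Schur function with the two-point function
(`schurHook_eq_twoPoint`). The behaviour under `t ↦ -t` comes from `h_n(-t) = (-1)^n h_n(t)`.
-/

noncomputable section

namespace CKP
open Function Finset

/-! ### Locally finite sums -/

theorem finsum_antidiagonal {M : Type*} [AddCommMonoid M] (f : ℕ × ℕ → M)
    (hf : HasFiniteSupport f) :
    ∑ᶠ r, ∑ p ∈ antidiagonal r, f p = ∑ᶠ i, ∑ᶠ j, f (i, j) := by
  rw [← finsum_curry f hf]
  have hf' : (support f).Finite := hf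
  have hs : support f ⊆ ↑hf'.toFinset := by simp
  rw [finsum_eq_sum_of_support_subset f hs,
    finsum_eq_sum_of_support_subset (s := hf'.toFinset.image fun p => p.1 + p.2),
    ← Finset.sum_fiberwise_of_maps_to (g := fun p : ℕ × ℕ => p.1 + p.2)
      (t := hf'.toFinset.image fun p => p.1 + p.2) (fun p hp => Finset.mem_image_of_mem _ hp)]
  · refine Finset.sum_congr rfl fun r _ => (Finset.sum_subset ?_ ?_).symm
    · intro p hp
      simpa using (Finset.mem_filter.1 hp).2
    · intro p hp hp'
      by_contra h0
      exact hp' (by simpa [h0] using hp)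
  · intro r hr
    obtain ⟨p, hp, h0⟩ := Finset.exists_ne_zero_of_sum_ne_zero hr
    simp only [HasAntidiagonal.mem_antidiagonal] at hp
    simp only [coe_image, Set.Finite.coe_toFinset, Set.mem_image]
    exact ⟨p, h0, hp⟩

theorem finsum_swap {α β M : Type*} [AddCommMonoid M] (f : α × β → M) (hf : HasFiniteSupport f) :
    ∑ᶠ i, ∑ᶠ j, f (i, j) = ∑ᶠ j, ∑ᶠ i, f (i, j) := by
  rw [← finsum_curry f hf, ← finsum_comp_equiv (Equiv.prodComm β α),
    finsum_curry (fun p => f (Equiv.prodComm β α p))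
      (Set.Finite.preimage (f := Equiv.prodComm β α) (Equiv.injective _).injOn hf)]
  rfl

/-- The sum of a family of endomorphisms, all but finitely many of which vanish on any given
vector. -/
def locSum {ι R M : Type*} [CommRing R] [AddCommGroup M] [Module R M] (A : ι → Module.End R M)
    (hA : ∀ v, HasFiniteSupport fun i => A i v) : Module.End R M where
  toFun v := ∑ᶠ i, A i v
  map_add' v w := by simp only [map_add, finsum_add_distrib (hA v) (hA w)]
  map_smul' c v := by simp only [map_smul, RingHom.id_apply, smul_finsum' c (hA v)]

theorem locSum_apply {ι R M : Type*} [CommRing R] [AddCommGroup M] [Module R M]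
    (A : ι → Module.End R M) (hA : ∀ v, HasFiniteSupport fun i => A i v) (v : M) :
    locSum A hA v = ∑ᶠ i, A i v := rfl

theorem locSum_commutator {ι R M : Type*} [CommRing R] [AddCommGroup M] [Module R M]
    (A : ι → Module.End R M) (hA : ∀ v, HasFiniteSupport fun i => A i v) (B : Module.End R M)
    (v : M) :
    locSum A hA (B v) - B (locSum A hA v) = ∑ᶠ i, (A i (B v) - B (A i v)) := by
  rw [locSum_apply, locSum_apply, map_finsum B (hA v), ← finsum_sub_distrib (hA _)]
  exact (hA v).subset fun i hi h0 => hi (by simp only at h0; simp [h0])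

/-! ### The operators `J_n` and `H(t)` -/

section
variable {R : Type*} [CommRing R]

/-- A bound beyond which the annihilation operators vanish on `v`. -/
def annBound (v : Fock R) : ℕ := v.vars.sup id + 1

theorem phi_eq_zero (v : Fock R) {l : ℤ} (hl : l < -annBound v) : phi l v = 0 := by
  obtain ⟨m, rfl⟩ : ∃ m : ℕ, l = Int.negSucc m := ⟨(-l - 1).toNat, by omega⟩
  have hm : m ∉ v.vars := fun hm => by
    have : m ≤ v.vars.sup id := Finset.le_sup (f := id) hm
    rw [annBound] at hl
    omega
  simp [phi, MvPolynomial.pderiv_eq_zero_of_notMem_vars hm]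

theorem phi_one_of_neg {l : ℤ} (hl : l < 0) : phi l (1 : Fock R) = 0 := by
  obtain ⟨m, rfl⟩ : ∃ m : ℕ, l = Int.negSucc m := ⟨(-l - 1).toNat, by omega⟩
  simp [phi]

theorem phi_natCast (m : ℕ) (v : Fock R) : phi (m : ℤ) v = MvPolynomial.X m * v := rfl

theorem phi_swap {k l : ℤ} (h : k ≠ -l - 1) (v : Fock R) : phi k (phi l v) = phi l (phi k v) := by
  have := phi_comm k l v
  rwa [if_neg h, sub_eq_zero] at this

/-- Only finitely many terms of `J_n` act nontrivially on `v`, and none if `n` is large. As `n > 0`,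
the two factors commute, so the term vanishes if either of them annihilates `v`. -/
theorem phi_phi_eq_zero (v : Fock R) (n : ℕ) (hn : 0 < n) (k : ℤ)
    (hk : k < -annBound v ∨ annBound v < k + 1 + n) : phi k (phi (-k - 1 - n) v) = 0 := by
  rcases hk with hk | hk
  · rw [phi_swap (by omega), phi_eq_zero v hk, map_zero]
  · rw [phi_eq_zero v (by omega), map_zero]

variable [Algebra ℂ R]

/-- The summand `(-1)^{j + 1/2} φ_j φ_{-j-n} / 2` of `J_n`, where `j = k + 1/2`. -/
def JTerm (n : ℕ) (k : ℤ) : Module.End R (Fock R) :=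
  (1 / 2 : ℂ) • (k + 1).negOnePow • (phi k ∘ₗ phi (-k - 1 - n))

theorem JTerm_apply (n : ℕ) (k : ℤ) (v : Fock R) :
    JTerm n k v = (1 / 2 : ℂ) • (k + 1).negOnePow • phi k (phi (-k - 1 - n) v) := rfl

theorem JTerm_finite (n : ℕ) (hn : 0 < n) (v : Fock R) :
    HasFiniteSupport fun k => JTerm n k v := by
  refine (Set.finite_Icc (-(annBound v) : ℤ) (annBound v)).subset fun k hk => ?_
  by_contra h
  refine hk ?_
  simp only [Set.mem_Icc] at h
  simp only
  rw [JTerm_apply, phi_phi_eq_zero v n hn k (by omega), smul_zero, smul_zero]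

theorem J_eq_locSum (n : ℕ) (hn : 0 < n) (v : Fock R) :
    J n v = locSum (JTerm n) (JTerm_finite n hn) v := by
  have h0 : HasFiniteSupport fun k : ℤ => (k + 1).negOnePow • phi k (phi (-k - 1 - n) v) := by
    refine (JTerm_finite n hn v).subset fun k hk h => hk ?_
    simp only [JTerm_apply] at h
    simpa using h
  rw [locSum_apply, J, smul_finsum' _ h0]
  rfl

theorem negOnePow_mul_self_smul {M : Type*} [AddCommGroup M] {a b : ℤ} (h : Even (a + b)) (v : M) :
    a.negOnePow • b.negOnePow • v = v := by
  rw [smul_smul, ← Int.negOnePow_add, Int.negOnePow_even _ h, one_smul]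

theorem JTerm_commutator (n : ℕ) (hn : Odd n) (k l : ℤ) (v : Fock R) :
    JTerm n k (phi l v) - phi l (JTerm n k v) =
      (if k = l - n then (1 / 2 : ℂ) • phi (l - n) v else 0) +
        if k = -l - 1 then (1 / 2 : ℂ) • phi (l - n) v else 0 := by
  have h1 := phi_comm (-k - 1 - n) l v
  have h2 := phi_comm k l (phi (-k - 1 - n) v)
  have e1 : phi (-k - 1 - n) (phi l v) = phi l (phi (-k - 1 - n) v) +
      if k = l - n then l.negOnePow • v else 0 := by
    rw [sub_eq_iff_eq_add'] at h1
    rw [h1]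
    congr 1
    exact if_congr (by omega) rfl rfl
  rw [sub_eq_iff_eq_add'] at h2
  rw [JTerm_apply, JTerm_apply, e1, map_add, h2, LinearMap.map_smul_of_tower,
    map_zsmul_unit (phi l), ← smul_sub, ← smul_sub, add_assoc, add_sub_cancel_left, smul_add,
    smul_add, add_comm]
  congr 1
  · split_ifs with h
    · subst h
      rw [map_zsmul_unit, negOnePow_mul_self_smul]
      obtain ⟨m, rfl⟩ := hn
      exact ⟨l - m, by push_cast; ring⟩
    · simp
  · split_ifs with h
    · subst h
      rw [negOnePow_mul_self_smul ⟨0, by ring⟩]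
      congr 3
      ring
    · simp

/-- `[J_n, φ_l] = φ_{l-n}`: for each of the two factors of the summands, exactly one term of the sum
fails to commute with `φ_l`, and either contributes half of the result. -/
theorem J_commutator (n : ℕ) (hn : Odd n) (l : ℤ) (v : Fock R) :
    J n (phi l v) - phi l (J n v) = phi (l - n) v := by
  rw [J_eq_locSum n hn.pos, J_eq_locSum n hn.pos, locSum_commutator]
  simp only [JTerm_commutator n hn]
  have hs (a : ℤ) (w : Fock R) : HasFiniteSupport fun k => if k = a then w else 0 :=
    (Set.finite_singleton a).subset fun k hk => by
      by_contra h
      exact hk (if_neg h)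
  rw [finsum_add_distrib (hs _ _) (hs _ _), finsum_eq_single _ (l - n) (fun x hx => if_neg hx),
    finsum_eq_single _ (-l - 1) (fun x hx => if_neg hx), if_pos rfl, if_pos rfl, ← add_smul]
  norm_num

theorem J_eq_zero (n : ℕ) (v : Fock R) (hn : 2 * annBound v + 1 ≤ n) : J n v = 0 := by
  rw [J_eq_locSum n (by omega), locSum_apply]
  refine finsum_eq_zero_of_forall_eq_zero fun k => ?_
  rw [JTerm_apply, phi_phi_eq_zero v n (by omega) k (by omega), smul_zero, smul_zero]

/-- The summand `t_{2m+1} J_{2m+1}` of `H(t)`. -/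
def HTerm (t : ℕ → R) (m : ℕ) : Module.End R (Fock R) :=
  t m • locSum (JTerm (2 * m + 1)) (JTerm_finite (2 * m + 1) (by omega))

theorem HTerm_apply (t : ℕ → R) (m : ℕ) (v : Fock R) : HTerm t m v = t m • J (2 * m + 1) v := by
  rw [J_eq_locSum _ (by omega)]
  rfl

theorem HTerm_finite (t : ℕ → R) (v : Fock R) : HasFiniteSupport fun m => HTerm t m v := by
  refine (Set.finite_Iio (annBound v)).subset fun m hm => ?_
  by_contra h
  refine hm ?_
  simp only [Set.mem_Iio] at h
  simp only
  rw [HTerm_apply, J_eq_zero _ v (by omega), smul_zero]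

/-- `H(t)` as a linear operator. -/
def HEnd (t : ℕ → R) : Module.End R (Fock R) := locSum (HTerm t) (HTerm_finite t)

theorem HEnd_apply (t : ℕ → R) (v : Fock R) : HEnd t v = H t v := by
  simp only [HEnd, locSum_apply, HTerm_apply, H]

theorem HEnd_one (t : ℕ → R) : HEnd t 1 = 0 := by
  rw [HEnd, locSum_apply]
  refine finsum_eq_zero_of_forall_eq_zero fun m => ?_
  rw [HTerm_apply, J_eq_locSum _ (by omega), locSum_apply]
  convert smul_zero _
  refine finsum_eq_zero_of_forall_eq_zero fun k => ?_
  rw [JTerm_apply]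
  convert smul_zero _
  convert smul_zero _
  by_cases hk : k < 0
  · rw [phi_swap (by omega), phi_one_of_neg hk, map_zero]
  · rw [phi_one_of_neg (by omega), map_zero]

theorem HEnd_commutator (t : ℕ → R) (l : ℤ) (v : Fock R) :
    HEnd t (phi l v) - phi l (HEnd t v) = ∑ᶠ m : ℕ, t m • phi (l - (2 * m + 1 : ℕ)) v := by
  rw [HEnd, locSum_commutator]
  refine finsum_congr fun m => ?_
  rw [HTerm_apply, HTerm_apply, map_smul, ← smul_sub, J_commutator _ ⟨m, rfl⟩]

end

/-! ### Conjugation of the bosons by `Γ(t)` -/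

section
variable {R : Type*} [CommRing R]

theorem smul_phi_finite (k : ℤ) (c : ℕ → R) (v : Fock R) :
    HasFiniteSupport fun i : ℕ => c i • phi (k - i) v := by
  refine (Set.finite_Iic (k + annBound v).toNat).subset fun i hi => ?_
  by_contra h
  refine hi ?_
  simp only [Set.mem_Iic] at h
  simp only
  rw [phi_eq_zero v (by omega), smul_zero]

/-- The locally finite combination `∑_i F_i φ_{k-i}` of bosons with the coefficients of a power
series `F`. -/
def Phi (k : ℤ) (F : PowerSeries R) : Module.End R (Fock R) :=
  locSum (fun i : ℕ => PowerSeries.coeff i F • phi (k - i))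
    (smul_phi_finite k fun i => PowerSeries.coeff i F)

theorem Phi_apply (k : ℤ) (F : PowerSeries R) (v : Fock R) :
    Phi k F v = ∑ᶠ i : ℕ, PowerSeries.coeff i F • phi (k - i) v := rfl

theorem Phi_one (k : ℤ) (v : Fock R) : Phi k 1 v = phi k v := by
  rw [Phi_apply, finsum_eq_single _ 0]
  · simp
  · intro i hi
    simp [PowerSeries.coeff_one, hi]

/-- Since `T` has no constant term, `T ^ s` only involves `φ_{k-i}` with `i ≥ s`, and these
annihilate `v` once `s` is large. -/
theorem Phi_pow_eq_zero (k : ℤ) (T : PowerSeries R) (hT : PowerSeries.constantCoeff T = 0)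
    (v : Fock R) (s : ℕ) (hs : (k + annBound v).toNat < s) (i : ℕ) :
    PowerSeries.coeff i (T ^ s) • phi (k - i) v = 0 := by
  by_cases hi : i < s
  · rw [PowerSeries.coeff_of_lt_order i, zero_smul]
    exact lt_of_lt_of_le (by exact_mod_cast hi)
      (PowerSeries.le_order_pow_of_constantCoeff_eq_zero s hT)
  · rw [phi_eq_zero v (by omega), smul_zero]

/-- Applied to `f u = H(t)^u v`, this says that the Leibniz expansions of `H(t)^r φ_k v` have only
finitely many nonzero terms, over all `r` together. -/
theorem Phi_pow_finite (k : ℤ) (T : PowerSeries R) (hT : PowerSeries.constantCoeff T = 0)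
    (f : ℕ → Fock R) (hf : HasFiniteSupport f) :
    HasFiniteSupport fun p : ℕ × ℕ => Phi k (T ^ p.1) (f p.2) := by
  have hf' : (support f).Finite := hf
  refine (hf'.biUnion fun u _ =>
    (Set.finite_Iic (k + annBound (f u)).toNat).prod (Set.finite_singleton u)).subset
      fun p hp => ?_
  simp only [Set.mem_iUnion]
  refine ⟨p.2, fun h0 => hp (by simp [h0]), ?_, rfl⟩
  by_contra h
  simp only [Set.mem_Iic, not_le] at h
  exact hp (finsum_eq_zero_of_forall_eq_zero fun i => Phi_pow_eq_zero k T hT _ _ h i)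

theorem constantCoeff_timeSeries (t : ℕ → R) : PowerSeries.constantCoeff (timeSeries t) = 0 := by
  rw [← PowerSeries.coeff_zero_eq_constantCoeff_apply, timeSeries, PowerSeries.coeff_mk]
  simp

variable [Algebra ℂ R]

theorem HEnd_phi (t : ℕ → R) (l : ℤ) (v : Fock R) :
    HEnd t (phi l v) = Phi l (timeSeries t) v + phi l (HEnd t v) := by
  rw [← sub_eq_iff_eq_add, HEnd_commutator, Phi_apply]
  have hinj : Injective fun m : ℕ => 2 * m + 1 := fun a b h => by simp only at h; omega
  rw [← finsum_mem_univ (fun i : ℕ => PowerSeries.coeff i (timeSeries t) • phi (l - i) v),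
    finsum_mem_inter_support_eq _ Set.univ (Set.range fun m : ℕ => 2 * m + 1),
    finsum_mem_range hinj]
  · refine finsum_congr fun m => ?_
    rw [timeSeries, PowerSeries.coeff_mk, if_pos ⟨m, rfl⟩]
    congr 2
    omega
  · ext i
    simp only [Set.univ_inter, Set.mem_inter_iff, iff_and_self]
    intro hi
    by_contra h
    refine hi ?_
    have : ¬ Odd i := fun ⟨m, hm⟩ => h ⟨m, hm.symm⟩
    simp [timeSeries, this]

/-- `[H(t), ∑_i F_i φ_{k-i}] = ∑_i (T F)_i φ_{k-i}`, where `T` is the series of the times. -/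
theorem HEnd_Phi (t : ℕ → R) (k : ℤ) (F : PowerSeries R) (v : Fock R) :
    HEnd t (Phi k F v) = Phi k (timeSeries t * F) v + Phi k F (HEnd t v) := by
  set T := timeSeries t
  have hfin : HasFiniteSupport fun p : ℕ × ℕ =>
      PowerSeries.coeff p.1 F • PowerSeries.coeff p.2 T • phi (k - p.1 - p.2) v := by
    refine ((Set.finite_Iic (k + annBound v).toNat).prod
      (Set.finite_Iic (k + annBound v).toNat)).subset fun p hp => ?_
    by_contra h
    refine hp ?_
    simp only [Set.mem_prod, Set.mem_Iic] at h
    simp only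
    rw [phi_eq_zero v (by omega), smul_zero, smul_zero]
  -- Both sides are the sum of `F_i T_j φ_{k-i-j} v` over all pairs `(i, j)`.
  have h1 : Phi k (T * F) v =
      ∑ᶠ i : ℕ, PowerSeries.coeff i F • Phi (k - i) T v := by
    rw [Phi_apply]
    simp only [Phi_apply (k - _)]
    rw [finsum_congr fun i : ℕ => smul_finsum' (PowerSeries.coeff i F) (smul_phi_finite (k - i)
      (fun j => PowerSeries.coeff j T) v), ← finsum_antidiagonal _ hfin]
    refine finsum_congr fun r => ?_
    rw [mul_comm, PowerSeries.coeff_mul, Finset.sum_smul]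
    refine Finset.sum_congr rfl fun p hp => ?_
    rw [HasAntidiagonal.mem_antidiagonal] at hp
    rw [mul_smul, ← hp]
    rw [Nat.cast_add, sub_sub]
  have hfin1 : HasFiniteSupport fun i : ℕ => PowerSeries.coeff i F • Phi (k - i) T v := by
    refine (Set.finite_Iic (k + annBound v).toNat).subset fun i hi => ?_
    by_contra h
    refine hi ?_
    simp only [Set.mem_Iic] at h
    simp only
    rw [Phi_apply, finsum_eq_zero_of_forall_eq_zero, smul_zero]
    intro j
    rw [phi_eq_zero v (by omega), smul_zero]
  rw [h1, Phi_apply, Phi_apply, map_finsum _ (smul_phi_finite k _ v),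
    ← finsum_add_distrib hfin1 (smul_phi_finite k (fun i => PowerSeries.coeff i F) _)]
  refine finsum_congr fun i => ?_
  rw [map_smul, HEnd_phi, smul_add]

/-- The Leibniz rule for the powers of `H(t)`. -/
theorem HEnd_pow_Phi (t : ℕ → R) (k : ℤ) (F : PowerSeries R) (v : Fock R) (r : ℕ) :
    (HEnd t ^ r) (Phi k F v) = ∑ p ∈ antidiagonal r,
      r.choose p.1 • Phi k (timeSeries t ^ p.1 * F) ((HEnd t ^ p.2) v) := by
  induction r with
  | zero => simp
  | succ r ih =>
    rw [Finset.sum_antidiagonal_choose_succ_nsmul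
      (fun a b => Phi k (timeSeries t ^ a * F) ((HEnd t ^ b) v)), pow_succ', Module.End.mul_apply,
      ih, map_sum, ← Finset.sum_add_distrib]
    refine Finset.sum_congr rfl fun p hp => ?_
    rw [HasAntidiagonal.mem_antidiagonal] at hp
    rw [map_nsmul, HEnd_Phi, smul_add, add_comm, Nat.choose_symm_of_eq_add hp.symm,
      pow_succ' _ p.2, Module.End.mul_apply, pow_succ' _ p.1, mul_assoc]

theorem HEnd_pow_phi (t : ℕ → R) (k : ℤ) (v : Fock R) (r : ℕ) :
    (HEnd t ^ r) (phi k v) = ∑ p ∈ antidiagonal r,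
      r.choose p.1 • Phi k (timeSeries t ^ p.1) ((HEnd t ^ p.2) v) := by
  rw [← Phi_one, HEnd_pow_Phi]
  simp only [mul_one]

/-- `H(t)` is locally nilpotent. -/
theorem HEnd_pow_finite (t : ℕ → R) (v : Fock R) :
    HasFiniteSupport fun r => (HEnd t ^ r) v := by
  induction v using MvPolynomial.induction_on with
  | C a =>
    refine (Set.finite_singleton 0).subset fun r hr => ?_
    by_contra h
    refine hr ?_
    obtain ⟨s, rfl⟩ := Nat.exists_eq_succ_of_ne_zero h
    have h1 : (MvPolynomial.C a : Fock R) = a • 1 := by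
      rw [MvPolynomial.smul_eq_C_mul, mul_one]
    simp only
    rw [h1, pow_succ, Module.End.mul_apply, map_smul, HEnd_one, smul_zero, map_zero]
  | add p q hp hq =>
    have hp' : Set.Finite _ := hp
    refine (hp'.union hq).subset fun r hr => ?_
    by_contra h
    simp only [Set.mem_union, mem_support, not_or, not_not] at h
    exact hr (by simp only [map_add, h, add_zero])
  | mul_X p k hp =>
    have hfin : Set.Finite _ :=
      Phi_pow_finite k (timeSeries t) (constantCoeff_timeSeries t) _ hp
    refine (hfin.image fun q => q.1 + q.2).subset fun r hr => ?_
    simp only [mem_support] at hr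
    rw [mul_comm, ← phi_natCast, HEnd_pow_phi] at hr
    obtain ⟨q, hq, h0⟩ := Finset.exists_ne_zero_of_sum_ne_zero hr
    rw [HasAntidiagonal.mem_antidiagonal] at hq
    exact ⟨q, fun h => h0 (by simp only at h; rw [h, smul_zero]), hq⟩

theorem GammaTerm_finite (t : ℕ → R) (v : Fock R) :
    HasFiniteSupport fun r => ((r ! : ℂ)⁻¹ • HEnd t ^ r) v :=
  (HEnd_pow_finite t v).subset fun r hr h => hr (by
    simp only at h
    simp only
    rw [LinearMap.smul_apply, h, smul_zero])

/-- `Γ(t)` as a linear operator. -/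
def GammaEnd (t : ℕ → R) : Module.End R (Fock R) :=
  locSum (fun r => (r ! : ℂ)⁻¹ • HEnd t ^ r) (GammaTerm_finite t)

theorem GammaEnd_apply (t : ℕ → R) (v : Fock R) : GammaEnd t v = Gamma t v := by
  have hH : H t = HEnd t := funext fun w => (HEnd_apply t w).symm
  rw [GammaEnd, locSum_apply, Gamma, hH]
  exact finsum_congr fun r => by rw [LinearMap.smul_apply, Module.End.pow_apply]

theorem GammaEnd_one (t : ℕ → R) : GammaEnd t 1 = 1 := by
  rw [GammaEnd, locSum_apply, finsum_eq_single _ 0]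
  · simp
  · intro r hr
    obtain ⟨s, rfl⟩ := Nat.exists_eq_succ_of_ne_zero hr
    rw [LinearMap.smul_apply, pow_succ, Module.End.mul_apply, HEnd_one, map_zero, smul_zero]

/-- The generating series `∑_n h_n(t) z^n`. -/
def hSeries (t : ℕ → R) : PowerSeries R := (PowerSeries.exp ℂ).subst (timeSeries t)

theorem coeff_hSeries (t : ℕ → R) (n : ℕ) : PowerSeries.coeff n (hSeries t) = h t n := rfl

theorem coeff_hSeries_eq_finsum (t : ℕ → R) (n : ℕ) : PowerSeries.coeff n (hSeries t) =
    ∑ᶠ s : ℕ, (s ! : ℂ)⁻¹ • PowerSeries.coeff n (timeSeries t ^ s) := by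
  rw [hSeries, PowerSeries.coeff_subst'
    (PowerSeries.HasSubst.of_constantCoeff_zero' (constantCoeff_timeSeries t))]
  refine finsum_congr fun s => ?_
  rw [PowerSeries.coeff_exp]
  simp

theorem Phi_hSeries (t : ℕ → R) (k : ℤ) (v : Fock R) :
    Phi k (hSeries t) v = ∑ᶠ s : ℕ, (s ! : ℂ)⁻¹ • Phi k (timeSeries t ^ s) v := by
  have hfin : HasFiniteSupport fun p : ℕ × ℕ =>
      (p.1 ! : ℂ)⁻¹ • PowerSeries.coeff p.2 (timeSeries t ^ p.1) • phi (k - p.2) v := by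
    refine ((Set.finite_Iic (k + annBound v).toNat).prod
      (Set.finite_Iic (k + annBound v).toNat)).subset fun p hp => ?_
    by_contra h
    refine hp ?_
    simp only [Set.mem_prod, Set.mem_Iic, not_and_or, not_le] at h
    simp only
    rcases h with h | h
    · rw [Phi_pow_eq_zero k _ (constantCoeff_timeSeries t) v _ h, smul_zero]
    · rw [phi_eq_zero v (by omega), smul_zero, smul_zero]
  simp only [Phi_apply]
  rw [finsum_congr fun s : ℕ => smul_finsum' ((s ! : ℂ)⁻¹) (smul_phi_finite k
      (fun j => PowerSeries.coeff j (timeSeries t ^ s)) v), finsum_swap _ hfin]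
  refine finsum_congr fun i => ?_
  simp only [← smul_assoc]
  rw [coeff_hSeries_eq_finsum, finsum_smul']
  refine (Set.finite_Iic i).subset fun s hs => ?_
  by_contra h
  refine hs ?_
  simp only [Set.mem_Iic, not_le] at h
  simp only
  rw [PowerSeries.coeff_of_lt_order i, smul_zero]
  exact lt_of_lt_of_le (by exact_mod_cast h)
    (PowerSeries.le_order_pow_of_constantCoeff_eq_zero s (constantCoeff_timeSeries t))

/-- `Γ(t) φ_k Γ(t)⁻¹ = ∑_i h_i(t) φ_{k-i}`. -/
theorem GammaEnd_phi (t : ℕ → R) (k : ℤ) (v : Fock R) :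
    GammaEnd t (phi k v) = Phi k (hSeries t) (GammaEnd t v) := by
  have hfin : HasFiniteSupport fun p : ℕ × ℕ =>
      (p.1 ! : ℂ)⁻¹ • Phi k (timeSeries t ^ p.1) (((p.2 ! : ℂ)⁻¹ • HEnd t ^ p.2) v) := by
    refine (Phi_pow_finite k (timeSeries t) (constantCoeff_timeSeries t) _
      (GammaTerm_finite t v)).subset fun p hp h => hp ?_
    simp only at h
    simp only
    rw [h, smul_zero]
  -- The divided powers turn the Leibniz rule into a Cauchy product.
  have h1 : Phi k (hSeries t) (GammaEnd t v) = ∑ᶠ s : ℕ, ∑ᶠ u : ℕ,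
      (s ! : ℂ)⁻¹ • Phi k (timeSeries t ^ s) (((u ! : ℂ)⁻¹ • HEnd t ^ u) v) := by
    rw [finsum_swap _ hfin, GammaEnd, locSum_apply, map_finsum _ (GammaTerm_finite t v)]
    exact finsum_congr fun u => Phi_hSeries t k _
  rw [h1, ← finsum_antidiagonal _ hfin, GammaEnd, locSum_apply]
  refine finsum_congr fun r => ?_
  rw [LinearMap.smul_apply, HEnd_pow_phi, Finset.smul_sum]
  refine Finset.sum_congr rfl fun p hp => ?_
  rw [HasAntidiagonal.mem_antidiagonal] at hp
  subst hp
  rw [LinearMap.smul_apply, LinearMap.map_smul_of_tower, smul_smul,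
    ← Nat.cast_smul_eq_nsmul ℂ, smul_smul]
  congr 1
  have := Nat.add_choose_mul_factorial_mul_factorial p.1 p.2
  rw [← Nat.choose_symm_add] at this
  have h2 : (((p.1 + p.2).choose p.1 : ℕ) : ℂ) * p.1 ! * p.2 ! = (p.1 + p.2)! := by
    exact_mod_cast this
  rw [← h2]
  have a1 : (p.1 ! : ℂ) ≠ 0 := by exact_mod_cast Nat.factorial_ne_zero _
  have a2 : (p.2 ! : ℂ) ≠ 0 := by exact_mod_cast Nat.factorial_ne_zero _
  have a3 : ((p.1 + p.2).choose p.1 : ℂ) ≠ 0 := by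
    exact_mod_cast (Nat.choose_pos (Nat.le_add_right _ _)).ne'
  field_simp

end

/-! ### Wick's theorem -/

section
variable {R : Type*} [CommRing R]

/-- The dual vacuum kills the creation part `∑_{i ≤ k} F_i φ_{k-i}` of `∑_i F_i φ_{k-i}`. The
annihilation part is again of this form, with `k = -1` and the shifted series. -/
theorem constantCoeff_Phi (k : ℕ) (F : PowerSeries R) (v : Fock R) :
    MvPolynomial.constantCoeff (Phi k F v) = MvPolynomial.constantCoeff
      (Phi (-1) (PowerSeries.mk fun m => PowerSeries.coeff (k + 1 + m) F) v) := by
  have hinj : Injective fun m : ℕ => k + 1 + m := fun a b h => by simp only at h; omega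
  rw [Phi_apply, Phi_apply, map_finsum _ (smul_phi_finite k _ v),
    map_finsum _ (smul_phi_finite (-1) _ v),
    ← finsum_mem_univ (fun i : ℕ => MvPolynomial.constantCoeff
      (PowerSeries.coeff i F • phi ((k : ℤ) - i) v)),
    finsum_mem_inter_support_eq _ Set.univ (Set.range fun m : ℕ => k + 1 + m),
    finsum_mem_range hinj]
  · refine finsum_congr fun m => ?_
    rw [PowerSeries.coeff_mk]
    congr 4
    omega
  · ext i
    simp only [Set.univ_inter, Set.mem_inter_iff, iff_and_self]
    intro hi
    by_contra h
    refine hi ?_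
    have hik : i ≤ k := by
      by_contra h'
      exact h ⟨i - (k + 1), by simp only; omega⟩
    simp only
    rw [← Nat.cast_sub hik, phi_natCast, MvPolynomial.smul_eq_C_mul, map_mul, map_mul,
      MvPolynomial.constantCoeff_X, zero_mul, mul_zero]

theorem Phi_phi (l : ℕ) (G : PowerSeries R) (i : ℕ) (v : Fock R) :
    phi (-1 - i) (Phi l G v) - Phi l G (phi (-1 - i) v) =
      if i ≤ l then ((-1) ^ i * PowerSeries.coeff (l - i) G) • v else 0 := by
  rw [← neg_sub, Phi, locSum_commutator, ← finsum_neg_distrib]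
  have hterm (j : ℕ) : -((PowerSeries.coeff j G • phi ((l : ℤ) - j)) (phi (-1 - i) v) -
      phi (-1 - i) ((PowerSeries.coeff j G • phi ((l : ℤ) - j)) v)) =
      if j + i = l then ((-1) ^ i * PowerSeries.coeff j G) • v else 0 := by
    rw [LinearMap.smul_apply, LinearMap.smul_apply, map_smul, ← smul_sub, phi_comm]
    by_cases h : j + i = l
    · rw [if_pos h, if_pos (by omega)]
      have : ((-1 : ℤ) - i).negOnePow = - (i : ℤ).negOnePow := by
        rw [show (-1 : ℤ) - i = -(i + 1) by ring, Int.negOnePow_neg, Int.negOnePow_succ]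
      rw [this, Int.negOnePow_def, zpow_natCast, Units.smul_def, mul_comm, mul_smul, ← smul_neg]
      congr 1
      simp [MvPolynomial.smul_eq_C_mul]
    · rw [if_neg h, if_neg (by omega), smul_zero, neg_zero]
  rw [finsum_congr hterm]
  split_ifs with h
  · rw [finsum_eq_single _ (l - i), if_pos (by omega)]
    intro j hj
    rw [if_neg (by omega)]
  · refine finsum_eq_zero_of_forall_eq_zero fun j => if_neg (by omega)

/-- The commutator of a combination of annihilation operators with `∑_j G_j φ_{l-j}` is a scalar. -/
theorem Phi_Phi (l : ℕ) (F G : PowerSeries R) (v : Fock R) :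
    Phi (-1) F (Phi l G v) = Phi l G (Phi (-1) F v) + (∑ p ∈ antidiagonal l,
      (-1) ^ p.1 * PowerSeries.coeff p.1 F * PowerSeries.coeff p.2 G) • v := by
  rw [← sub_eq_iff_eq_add', Phi, locSum_commutator, Finset.Nat.sum_antidiagonal_eq_sum_range_succ
    (fun a b => (-1) ^ a * PowerSeries.coeff a F * PowerSeries.coeff b G), Finset.sum_smul]
  have hterm (i : ℕ) : (PowerSeries.coeff i F • phi (-1 - i)) (Phi l G v) -
      Phi l G ((PowerSeries.coeff i F • phi (-1 - i)) v) =
      if i ≤ l then ((-1) ^ i * PowerSeries.coeff i F * PowerSeries.coeff (l - i) G) • v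
      else 0 := by
    rw [LinearMap.smul_apply, LinearMap.smul_apply, map_smul, ← smul_sub, Phi_phi, smul_ite,
      smul_zero, smul_smul]
    congr 2
    ring
  rw [finsum_congr hterm, finsum_eq_sum_of_support_subset (s := range (l + 1))]
  · refine Finset.sum_congr rfl fun i hi => if_pos ?_
    rw [Finset.mem_range] at hi
    omega
  · intro i hi
    by_contra h
    refine hi (if_neg ?_)
    simpa using h

theorem Phi_neg_one_one (F : PowerSeries R) : Phi (-1) F 1 = 0 := by
  rw [Phi_apply]
  refine finsum_eq_zero_of_forall_eq_zero fun i => ?_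
  rw [phi_one_of_neg (by omega), smul_zero]

theorem derivation_prod {A : Type*} [CommRing A] [Algebra R A] (D : Derivation R A A) {n : ℕ}
    (f : Fin (n + 1) → A) : D (∏ i, f i) = ∑ j, D (f j) * ∏ i, f (j.succAbove i) := by
  induction n with
  | zero => simp
  | succ n ih =>
    rw [Fin.prod_univ_succ, Derivation.leibniz, ih, Fin.sum_univ_succ _ (n := n + 1), smul_eq_mul,
      smul_eq_mul, mul_comm _ (D (f 0)), add_comm, Finset.mul_sum]
    congr 1
    refine Finset.sum_congr rfl fun j _ => ?_
    rw [Fin.prod_univ_succ (fun i => f (j.succ.succAbove i))]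
    simp only [Fin.succ_succAbove_zero, Fin.succ_succAbove_succ]
    ring

variable [Algebra ℂ R]

/-- The two-point function `⟨0| Γ(t) φ_k φ_l |0⟩`, given by its explicit formula
`∑_{p=0}^{l} (-1)^p h_{k+1+p} h_{l-p}`. -/
def twoPoint (t : ℕ → R) (k l : ℕ) : R :=
  ∑ p ∈ antidiagonal l, (-1) ^ p.1 * h t (k + 1 + p.1 : ℕ) * h t p.2

/-- The derivation of the Fock space sending `X_l` to the two-point function of `k` and `l`. -/
def contraction (t : ℕ → R) (k : ℕ) : Derivation R (Fock R) (Fock R) :=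
  MvPolynomial.mkDerivation R fun l => MvPolynomial.C (twoPoint t k l)

/-- The annihilation part of `Γ(t) φ_k Γ(t)⁻¹`, conjugated back by `Γ(t)`, is a derivation: it kills
the vacuum, and its commutators with the creation operators are the two-point functions. -/
theorem annihilation_GammaEnd (t : ℕ → R) (k : ℕ) (v : Fock R) :
    Phi (-1) (PowerSeries.mk fun m => PowerSeries.coeff (k + 1 + m) (hSeries t))
      (GammaEnd t v) = GammaEnd t (contraction t k v) := by
  induction v using MvPolynomial.induction_on with
  | C a =>
    have h1 : (MvPolynomial.C a : Fock R) = a • 1 := by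
      rw [MvPolynomial.smul_eq_C_mul, mul_one]
    rw [h1, map_smul, map_smul, GammaEnd_one, Phi_neg_one_one, Derivation.map_smul, map_smul,
      Derivation.map_one_eq_zero, map_zero]
  | add p q hp hq => simp only [map_add, hp, hq]
  | mul_X p l hp =>
    rw [mul_comm, ← phi_natCast, GammaEnd_phi, Phi_Phi, hp, ← GammaEnd_phi, phi_natCast l p,
      Derivation.leibniz, contraction, MvPolynomial.mkDerivation_X, map_add, smul_eq_mul,
      phi_natCast, smul_eq_mul, mul_comm p, ← MvPolynomial.smul_eq_C_mul, map_smul]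
    simp only [PowerSeries.coeff_mk, twoPoint, coeff_hSeries]

/-- The functional `v ↦ ⟨0| Γ(t) v`. -/
def correlator (t : ℕ → R) (v : Fock R) : R := MvPolynomial.constantCoeff (GammaEnd t v)

theorem correlator_one (t : ℕ → R) : correlator t 1 = 1 := by
  rw [correlator, GammaEnd_one, map_one]

theorem correlator_C (t : ℕ → R) (a : R) : correlator t (MvPolynomial.C a) = a := by
  rw [correlator, ← mul_one (MvPolynomial.C a), ← MvPolynomial.smul_eq_C_mul, map_smul,
    GammaEnd_one, MvPolynomial.smul_eq_C_mul, mul_one, MvPolynomial.constantCoeff_C]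

/-- Wick's theorem: a boson on the left may be contracted with each of the others in turn. -/
theorem correlator_X_mul (t : ℕ → R) (k : ℕ) (v : Fock R) :
    correlator t (MvPolynomial.X k * v) = correlator t (contraction t k v) := by
  rw [correlator, ← phi_natCast, GammaEnd_phi, constantCoeff_Phi, annihilation_GammaEnd, correlator]

theorem correlator_X_mul_X (t : ℕ → R) (k l : ℕ) :
    correlator t (MvPolynomial.X k * MvPolynomial.X l) = twoPoint t k l := by
  rw [correlator_X_mul, contraction, MvPolynomial.mkDerivation_X, correlator_C]

/-- The symmetry expresses that the creation operators commute. -/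
theorem twoPoint_symm (t : ℕ → R) (k l : ℕ) : twoPoint t k l = twoPoint t l k := by
  rw [← correlator_X_mul_X, mul_comm, correlator_X_mul_X]

/-- The correlator of `n` creation operators `φ_{k_i}`. -/
def nPoint (t : ℕ → R) {n : ℕ} (k : Fin n → ℕ) : R := correlator t (∏ i, MvPolynomial.X (k i))

theorem nPoint_zero (t : ℕ → R) (k : Fin 0 → ℕ) : nPoint t k = 1 := by
  rw [nPoint, Fin.prod_univ_zero, correlator_one]

theorem nPoint_one (t : ℕ → R) (k : Fin 1 → ℕ) : nPoint t k = 0 := by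
  rw [nPoint, Fin.prod_univ_one, ← mul_one (MvPolynomial.X _), correlator_X_mul,
    Derivation.map_one_eq_zero, correlator, map_zero, map_zero]

theorem nPoint_succ_succ (t : ℕ → R) {n : ℕ} (k : Fin (n + 2) → ℕ) : nPoint t k =
    ∑ j : Fin (n + 1), twoPoint t (k 0) (k j.succ) * nPoint t fun i => k (j.succAbove i).succ := by
  rw [nPoint, Fin.prod_univ_succ, correlator_X_mul, derivation_prod, correlator, map_sum, map_sum]
  refine Finset.sum_congr rfl fun j _ => ?_
  rw [contraction, MvPolynomial.mkDerivation_X, ← MvPolynomial.smul_eq_C_mul, map_smul,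
    MvPolynomial.smul_eq_C_mul, map_mul, MvPolynomial.constantCoeff_C]
  rfl

/-! ### Hook Schur functions -/

theorem h_zero (t : ℕ → R) : h t 0 = 1 := by
  change PowerSeries.coeff 0 (hSeries t) = 1
  rw [coeff_hSeries_eq_finsum, finsum_eq_single _ 0]
  · simp
  · intro s hs
    simp [constantCoeff_timeSeries, hs]

theorem h_of_neg (t : ℕ → R) {n : ℤ} (hn : n < 0) : h t n = 0 := by
  obtain ⟨m, rfl⟩ : ∃ m : ℕ, n = Int.negSucc m := ⟨(-n - 1).toNat, by omega⟩
  rfl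

theorem twoPoint_zero (t : ℕ → R) (k : ℕ) : twoPoint t k 0 = h t (k + 1 : ℕ) := by
  have := h_zero t
  simp [twoPoint, this]

/-- The term with `p = 0` in the definition is `h_{k+1} h_{l+1}`, and `h_{l+1}` is the two-point
function of `l` and `0`. -/
theorem twoPoint_succ (t : ℕ → R) (k l : ℕ) : twoPoint t k (l + 1) =
    h t (k + 1 : ℕ) * twoPoint t 0 l - twoPoint t (k + 1) l := by
  rw [twoPoint_symm t 0 l, twoPoint_zero, twoPoint, twoPoint,
    Finset.Nat.sum_antidiagonal_succ, sub_eq_add_neg, ← Finset.sum_neg_distrib]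
  congr 1
  · simp
  · refine Finset.sum_congr rfl fun p _ => ?_
    rw [pow_succ, show k + 1 + (p.1 + 1) = k + 1 + 1 + p.1 by ring]
    ring

theorem schurHook_zero (t : ℕ → R) (n : ℕ) : schurHook t n 0 = h t (n + 1 : ℕ) := by
  simp [schurHook, schur]

/-- Expansion of the Jacobi-Trudi determinant along the first column, in which only the first two
entries `h_{n+1}` and `h_0 = 1` are nonzero. -/
theorem schurHook_succ (t : ℕ → R) (n m : ℕ) : schurHook t n (m + 1) =
    h t (n + 1 : ℕ) * schurHook t 0 m - schurHook t (n + 1) m := by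
  rw [schurHook, schur, Matrix.det_succ_column_zero, Fin.sum_univ_succ, Fin.sum_univ_succ,
    Finset.sum_eq_zero, add_zero, sub_eq_add_neg]
  · congr 1
    · rw [schurHook, schur, Fin.val_zero, pow_zero, one_mul]
      congr 2
      · ext i j
        simp only [Matrix.submatrix_apply, Matrix.of_apply, Fin.succAbove_zero, Fin.cons_succ,
          Fin.val_succ]
        congr 1
        refine Fin.cases ?_ (fun i => ?_) i <;> simp <;> ring
    · have h0 := h_zero t
      have hentry : (-1 : R) ^ ((Fin.succ 0 : Fin (m + 1 + 1)) : ℕ) * (Matrix.of fun i j =>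
          h t (((Fin.cons (n + 1) (fun _ => 1) : Fin (m + 1 + 1) → ℕ) i : ℤ) - (i : ℕ) +
            (j : ℕ)) : Matrix (Fin (m + 1 + 1)) (Fin (m + 1 + 1)) R) (Fin.succ 0) 0 = -1 := by
        simp [h0]
      rw [hentry, neg_one_mul, schurHook, schur]
      congr 2
      ext i j
      simp only [Matrix.submatrix_apply, Matrix.of_apply, Fin.val_succ]
      congr 1
      refine Fin.cases ?_ (fun i => ?_) i
      · simp
        ring
      · rw [Fin.succ_succAbove_succ]
        simp
        ring
  · intro i _
    rw [Matrix.of_apply, h_of_neg, mul_zero, zero_mul]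
    simp
    omega

theorem schurHook_eq_twoPoint (t : ℕ → R) (n m : ℕ) : schurHook t n m = twoPoint t n m := by
  induction m generalizing n with
  | zero => rw [schurHook_zero, twoPoint_zero]
  | succ m ih => rw [schurHook_succ, twoPoint_succ, ih, ih]

/-! ### The reflection `t ↦ -t` -/

theorem h_neg (t : ℕ → R) (n : ℕ) : h (-t) n = (-1) ^ n * h t n := by
  have hT : timeSeries (-t) = PowerSeries.rescale (-1) (timeSeries t) := by
    ext n
    rw [PowerSeries.coeff_rescale, timeSeries, timeSeries, PowerSeries.coeff_mk,
      PowerSeries.coeff_mk]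
    split_ifs with hn
    · simp [hn.neg_one_pow]
    · simp
  rw [← coeff_hSeries, ← coeff_hSeries, coeff_hSeries_eq_finsum, coeff_hSeries_eq_finsum, hT,
    mul_finsum']
  · refine finsum_congr fun s => ?_
    rw [← map_pow, PowerSeries.coeff_rescale, mul_smul_comm]
  · refine (Set.finite_Iic n).subset fun s hs => ?_
    by_contra h
    refine hs ?_
    simp only [Set.mem_Iic, not_le] at h
    simp only
    rw [PowerSeries.coeff_of_lt_order n, smul_zero]
    exact lt_of_lt_of_le (by exact_mod_cast h)
      (PowerSeries.le_order_pow_of_constantCoeff_eq_zero s (constantCoeff_timeSeries t))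

theorem twoPoint_neg (t : ℕ → R) (k l : ℕ) :
    twoPoint (-t) k l = (-1) ^ (k + l + 1) * twoPoint t k l := by
  rw [twoPoint, twoPoint, Finset.mul_sum]
  refine Finset.sum_congr rfl fun p hp => ?_
  rw [HasAntidiagonal.mem_antidiagonal] at hp
  rw [h_neg, h_neg, ← hp]
  ring

theorem nPoint_neg (t : ℕ → R) (n : ℕ) {l : ℕ} (hl : l = 2 * n) (k : Fin l → ℕ) :
    nPoint (-t) k = (-1) ^ (∑ i, k i + n) * nPoint t k := by
  subst hl
  induction n with
  | zero => rw [nPoint_zero, nPoint_zero]; simp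
  | succ n ih =>
    have e1 := nPoint_succ_succ (-t) (n := 2 * n) k
    have e2 := nPoint_succ_succ t (n := 2 * n) k
    refine e1.trans (Eq.trans ?_ (congrArg _ e2).symm)
    rw [Finset.mul_sum]
    refine Finset.sum_congr rfl fun j _ => ?_
    rw [ih, twoPoint_neg]
    have e3 : ∑ i, k i = k 0 + (k j.succ + ∑ i, k (j.succAbove i).succ) := by
      rw [← Fin.sum_univ_succAbove (fun i : Fin (2 * n + 1) => k i.succ) j]
      exact Fin.sum_univ_succ (n := 2 * n + 1) k
    rw [e3]
    ring

end

/-! ### Expansion of the Hafnian along the first row -/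

section
variable {n : ℕ}

/-- The pairs of positions in a list of `n + 2` indices: the first pair, and the pairs
in the rest. -/
def pairIdx (n : ℕ) : Fin (n / 2 + 1) ≃o Fin ((n + 2) / 2) := Fin.castOrderIso (by omega)

theorem fstIdx_zero : fstIdx (pairIdx n 0) = 0 := rfl

theorem sndIdx_zero : sndIdx (pairIdx n 0) = Fin.succ 0 := rfl

theorem fstIdx_succ (i : Fin (n / 2)) : fstIdx (pairIdx n i.succ) = (fstIdx i).succ.succ := rfl

theorem sndIdx_succ (i : Fin (n / 2)) : sndIdx (pairIdx n i.succ) = (sndIdx i).succ.succ := rfl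

/-- The condition under which a permutation lists the pairs of a perfect matching in the
normalized order. -/
def IsMatchingPerm (σ : Equiv.Perm (Fin n)) : Prop :=
  (∀ i : Fin (n / 2), σ (fstIdx i) < σ (sndIdx i)) ∧ StrictMono fun i : Fin (n / 2) => σ (fstIdx i)

/-- The permutation `0, j + 1, …` which matches `0` with `j + 1` and lists the remaining indices in
the order given by `τ`. -/
def insertPair (j : Fin (n + 1)) (τ : Equiv.Perm (Fin n)) : Equiv.Perm (Fin (n + 2)) :=
  Equiv.ofBijective (Fin.cons 0 (Fin.cons j.succ fun i => (j.succAbove (τ i)).succ))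
    (Finite.injective_iff_bijective.1 (by
      rw [Fin.cons_injective_iff, Fin.cons_injective_iff]
      refine ⟨?_, ?_, fun a b hab => ?_⟩
      · rintro ⟨i, hi⟩
        induction i using Fin.cases <;> simp at hi
      · rintro ⟨i, hi⟩
        exact Fin.succAbove_ne _ _ (Fin.succ_injective _ hi)
      · exact τ.injective (Fin.succAbove_right_injective (Fin.succ_injective _ hab))))

theorem insertPair_zero (j : Fin (n + 1)) (τ : Equiv.Perm (Fin n)) : insertPair j τ 0 = 0 := rfl

theorem insertPair_one (j : Fin (n + 1)) (τ : Equiv.Perm (Fin n)) :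
    insertPair j τ (Fin.succ 0) = j.succ := rfl

theorem insertPair_succ_succ (j : Fin (n + 1)) (τ : Equiv.Perm (Fin n)) (i : Fin n) :
    insertPair j τ i.succ.succ = (j.succAbove (τ i)).succ := rfl

theorem isMatchingPerm_insertPair (j : Fin (n + 1)) (τ : Equiv.Perm (Fin n)) :
    IsMatchingPerm (insertPair j τ) ↔ IsMatchingPerm τ := by
  have hlt (a b : Fin n) : (j.succAbove a).succ < (j.succAbove b).succ ↔ a < b := by
    rw [Fin.succ_lt_succ_iff, Fin.succAbove_lt_succAbove_iff]
  refine and_congr ?_ ?_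
  · rw [← (pairIdx n).toEquiv.forall_congr_right]
    simp only [RelIso.coe_fn_toEquiv, Fin.forall_fin_succ, fstIdx_zero, sndIdx_zero, fstIdx_succ,
      sndIdx_succ, insertPair_zero, insertPair_one, insertPair_succ_succ, hlt, Fin.succ_pos,
      true_and]
  · constructor
    · intro hm a b hab
      have := hm ((pairIdx n).strictMono (Fin.succ_lt_succ_iff.2 hab))
      simpa only [fstIdx_succ, insertPair_succ_succ, hlt] using this
    · intro hm a b hab
      obtain ⟨a, rfl⟩ := (pairIdx n).surjective a
      obtain ⟨b, rfl⟩ := (pairIdx n).surjective b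
      rw [(pairIdx n).lt_iff_lt] at hab
      induction b using Fin.cases with
      | zero => exact absurd hab (Fin.not_lt_zero a)
      | succ b =>
        induction a using Fin.cases with
        | zero => simp [fstIdx_zero, fstIdx_succ, insertPair_zero, insertPair_succ_succ]
        | succ a =>
          simp only [fstIdx_succ, insertPair_succ_succ, hlt]
          exact hm (Fin.succ_lt_succ_iff.1 hab)

/-- As `n` is even, every index is a first or a second entry of some pair. An entry equal to `0`
cannot be a second entry, nor the first entry of a later pair. -/
theorem IsMatchingPerm.apply_zero (hn : Even n) {σ : Equiv.Perm (Fin (n + 2))}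
    (hσ : IsMatchingPerm σ) : σ 0 = 0 := by
  obtain ⟨x, hx⟩ := σ.surjective 0
  rw [Nat.even_iff] at hn
  have hxlt := x.isLt
  rcases Nat.even_or_odd' x.val with ⟨i, hi | hi⟩
  · have hxi : x = fstIdx (⟨i, by omega⟩ : Fin ((n + 2) / 2)) := Fin.ext hi
    rcases Nat.eq_zero_or_pos i with rfl | hpos
    · have hx0 : x = 0 := hxi
      rwa [hx0] at hx
    · have := hσ.2 (show pairIdx n 0 < ⟨i, by omega⟩ from hpos)
      simp only [← hxi, hx] at this
      exact absurd this (Fin.not_lt_zero _)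
  · have hxi : x = sndIdx (⟨i, by omega⟩ : Fin ((n + 2) / 2)) := Fin.ext hi
    have := hσ.1 ⟨i, by omega⟩
    rw [← hxi, hx] at this
    exact absurd this (Fin.not_lt_zero _)

theorem exists_eq_insertPair {σ : Equiv.Perm (Fin (n + 2))} (h0 : σ 0 = 0) :
    ∃ j τ, insertPair j τ = σ := by
  have hne (i : Fin (n + 1)) : σ i.succ ≠ 0 := fun h =>
    Fin.succ_ne_zero i (σ.injective (h.trans h0.symm))
  obtain ⟨j, hj⟩ := Fin.exists_succ_eq.2 (hne 0)
  have hex (i : Fin n) : ∃ z, (j.succAbove z).succ = σ i.succ.succ := by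
    obtain ⟨y, hy⟩ := Fin.exists_succ_eq.2 (hne i.succ)
    have hyj : y ≠ j := by
      rintro rfl
      have := Fin.succ_injective _ (σ.injective (hj.symm.trans hy))
      exact Fin.succ_ne_zero _ this.symm
    obtain ⟨z, rfl⟩ := Fin.exists_succAbove_eq hyj
    exact ⟨z, hy⟩
  choose τ hτ using hex
  have hinj : Injective τ := fun a b hab => by
    have := (hτ a).symm.trans ((by rw [hab] : _ = _).trans (hτ b))
    exact Fin.succ_injective _ (Fin.succ_injective _ (σ.injective this))
  refine ⟨j, Equiv.ofBijective τ (Finite.injective_iff_bijective.1 hinj), Equiv.ext fun i => ?_⟩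
  induction i using Fin.cases with
  | zero => exact h0.symm
  | succ i =>
    induction i using Fin.cases with
    | zero => exact hj
    | succ i => exact hτ i

theorem insertPair_injective : Injective fun p : Fin (n + 1) × Equiv.Perm (Fin n) =>
    insertPair p.1 p.2 := by
  rintro ⟨j, τ⟩ ⟨j', τ'⟩ h
  simp only at h
  have hj : j = j' := Fin.succ_injective _ (DFunLike.congr_fun h (Fin.succ 0))
  subst hj
  have hτ : τ = τ' := Equiv.ext fun i => Fin.succAbove_right_injective
    (Fin.succ_injective _ (DFunLike.congr_fun h i.succ.succ))
  rw [hτ]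

/-- Expansion along the first row: deleting the row and column `0` together with the row and column
`j + 1` keeps the order of the remaining indices. -/
theorem hafnian_succ_succ {S : Type*} [CommRing S] (hn : Even n)
    (A : Matrix (Fin (n + 2)) (Fin (n + 2)) S) : hafnian A = ∑ j : Fin (n + 1), A 0 j.succ *
      hafnian (A.submatrix (fun i => (j.succAbove i).succ) fun i => (j.succAbove i).succ) := by
  classical
  simp only [hafnian, Finset.mul_sum]
  rw [← Finset.sum_product']
  symm
  refine Finset.sum_bij (fun p _ => insertPair p.1 p.2) ?_ ?_ ?_ ?_
  · intro p hp
    rw [Finset.mem_product, Finset.mem_filter] at hp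
    exact Finset.mem_filter.2 ⟨mem_univ _, (isMatchingPerm_insertPair p.1 p.2).2 hp.2.2⟩
  · exact fun p _ q _ h => insertPair_injective h
  · intro σ hσ
    have hσ' : IsMatchingPerm σ := (Finset.mem_filter.1 hσ).2
    obtain ⟨j, τ, rfl⟩ := exists_eq_insertPair (hσ'.apply_zero hn)
    exact ⟨(j, τ), Finset.mem_product.2 ⟨mem_univ _, Finset.mem_filter.2
      ⟨mem_univ _, (isMatchingPerm_insertPair j τ).1 hσ'⟩⟩, rfl⟩
  · intro p _
    rw [← (pairIdx n).toEquiv.prod_comp, Fin.prod_univ_succ]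
    rfl

theorem hafnian_zero {S : Type*} [CommRing S] (A : Matrix (Fin 0) (Fin 0) S) : hafnian A = 1 := by
  classical
  rw [hafnian, Finset.filter_true_of_mem, Finset.univ_unique, Finset.sum_singleton]
  · rfl
  · intro σ _
    exact ⟨fun i => i.elim0, fun i => i.elim0⟩

end

/-! ### The functions `C_λ` -/

section
variable {R : Type*} [CommRing R]

theorem prod_phi_vacuum {n : ℕ} (k : Fin n → ℕ) :
    (List.ofFn fun i => phi (R := R) (k i : ℤ)).prod (vacuum R) =
      ∏ i, MvPolynomial.X (k i) := by
  induction n with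
  | zero => simp [vacuum]
  | succ n ih =>
    rw [List.ofFn_succ, List.prod_cons, Module.End.mul_apply, ih fun i => k i.succ, phi_natCast,
      Fin.prod_univ_succ]

variable [Algebra ℂ R]

theorem nPoint_eq_hafnian (t : ℕ → R) (n : ℕ) (hn : Even n) (k : Fin n → ℕ) :
    nPoint t k = hafnian (Matrix.of fun i j => twoPoint t (k i) (k j)) := by
  induction n using Nat.strong_induction_on with
  | _ n ih =>
    match n, hn with
    | 0, _ => rw [nPoint_zero, hafnian_zero]
    | 1, hn => exact absurd hn (by decide)
    | n + 2, hn =>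
      have hn' : Even n := by simpa [Nat.even_add] using hn
      rw [nPoint_succ_succ, hafnian_succ_succ hn']
      refine Finset.sum_congr rfl fun j _ => ?_
      rw [ih n (by omega) hn']
      rfl

theorem nPoint_of_odd (t : ℕ → R) (n : ℕ) (hn : Odd n) (k : Fin n → ℕ) : nPoint t k = 0 := by
  induction n using Nat.strong_induction_on with
  | _ n ih =>
    match n, hn with
    | 0, hn => exact absurd hn (by decide)
    | 1, _ => exact nPoint_one t k
    | n + 2, hn =>
      have hn' : Odd n := by simpa [Nat.odd_add] using hn
      rw [nPoint_succ_succ]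
      refine Finset.sum_eq_zero fun j _ => ?_
      rw [ih n (by omega) hn', mul_zero]

theorem C_eq_nPoint (d : OddPartition → ℂ) (lam : OddPartition) (t : ℕ → R) :
    C d lam t = (d lam)⁻¹ • nPoint t lam.half := by
  rw [C, ket, ← GammaEnd_apply, prod_phi_vacuum, LinearMap.map_smul_of_tower, dualVacuum, nPoint,
    correlator, MvPolynomial.constantCoeff_smul]

end

namespace OddPartition

theorem parts_eq (lam : OddPartition) (i : Fin lam.length) :
    lam.parts i = 2 * lam.half i + 1 := by
  have := lam.odd i
  rw [Nat.odd_iff] at this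
  rw [half]
  omega

theorem weight_half (lam : OddPartition) (n : ℕ) (hn : lam.length = 2 * n) :
    lam.weight / 2 = ∑ i, lam.half i + n := by
  simp only [weight, parts_eq, Finset.sum_add_distrib, ← Finset.mul_sum, Finset.sum_const,
    Finset.card_univ, Fintype.card_fin, smul_eq_mul, mul_one]
  omega

end OddPartition
end CKP
end

theorem mainTheorem3 {R : Type*} [CommRing R] [Algebra ℂ R]
    (d : CKP.OddPartition → ℂ) (hd : CKP.IsNormalization d) (t : ℕ → R) :
    -- the one-hook Schur functions are symmetric, and give the two-part functions
    (∀ n m : ℕ, CKP.schurHook t n m = CKP.schurHook t m n) ∧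
    (∀ (n m : ℕ) (hmn : m ≤ n),
      CKP.C d (CKP.OddPartition.pair n m hmn) t =
        (d (CKP.OddPartition.pair n m hmn))⁻¹ • CKP.schurHook t n m) ∧
    ∀ lam : CKP.OddPartition,
      (Odd lam.length → CKP.C d lam t = 0) ∧
      (Even lam.length →
        CKP.C d lam t = (d lam)⁻¹ • CKP.hafnian (CKP.hookMatrix lam t)) ∧
      (Even lam.length →
        CKP.C d lam (-t) = (-1) ^ (lam.weight / 2) * CKP.C d lam t) := by
  refine ⟨fun n m => ?_, fun n m hmn => ?_, fun lam => ⟨fun hodd => ?_, fun heven => ?_,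
    fun heven => ?_⟩⟩
  · rw [CKP.schurHook_eq_twoPoint, CKP.schurHook_eq_twoPoint, CKP.twoPoint_symm]
  · rw [CKP.C_eq_nPoint, CKP.schurHook_eq_twoPoint, ← CKP.correlator_X_mul_X]
    congr 1
    have h0 : (CKP.OddPartition.pair n m hmn).half (0 : Fin 2) = n := by
      change (2 * n + 1) / 2 = n
      omega
    have h1 : (CKP.OddPartition.pair n m hmn).half (1 : Fin 2) = m := by
      change (2 * m + 1) / 2 = m
      omega
    have := Fin.prod_univ_two fun i : Fin 2 =>
      (MvPolynomial.X ((CKP.OddPartition.pair n m hmn).half i) : CKP.Fock R)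
    rw [h0, h1] at this
    rw [← this]
    rfl
  · rw [CKP.C_eq_nPoint, CKP.nPoint_of_odd t _ hodd, smul_zero]
  · rw [CKP.C_eq_nPoint, CKP.nPoint_eq_hafnian t _ heven]
    simp only [← CKP.schurHook_eq_twoPoint]
    rfl
  · obtain ⟨n, hn⟩ := heven.exists_two_nsmul
    rw [smul_eq_mul] at hn
    rw [CKP.C_eq_nPoint, CKP.C_eq_nPoint, CKP.nPoint_neg t n hn, lam.weight_half n hn,
      mul_smul_comm]
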